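/- An abstract storage device (ASD) $D$ consists of a finite set $\mathcal S(D)$ of states and a set $\Pi(D)$ of partitions of $\mathcal S(D)$. For a partition $\pi$ of a set $T$ and a map $\phi: S\to T$, let $\pi\circ\phi$ be the partition of $S$ in which $x,y$ lie in the same block iff $\phi(x),\phi(y)$ lie in the same block of $\pi$. Write $D\le D'$ if there are functions $\phi:\mathcal S(D)\to\mathcal S(D')$ and $\alpha:\Pi(D)\to\Pi(D')$ such that $\alpha(\pi)\circ\phi$ refines $\pi$ for all $\pi\in\Pi(D)$, and call $D,D'$ equivalent if $D\le D'$ and $D'\le D$. The direct product of $D_1,\dots,D_m$ has state set $\prod_i\mathcal S(D_i)$ and as partitions all products $\pi_1\times\cdots\times\pi_m$ with $\pi_i\in\Pi(D_i)$, where two tuples lie in the same block of $\pi_1\times\cdots\times\pi_m$ iff for each $i$ their $i$-th entries lie in the same block of $\pi_i$ (the empty product is the one-state device with its only partition). For $n\ge 1$, the binary linear device $L_n$ has state set $\{0,1\}^n$, and its partitions are the kernel partitions $\{f^{-1}(y)\}_{y\in\operatorname{range} f}$ of all $\mathrm{GF}(2)$-linear maps $f:\{0,1\}^n\to\{0,1\}$.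 **Corollary.** Let $m,n\ge 0$ and let $k_1,\dots,k_m,r_1,\dots,r_n\ge 1$ be integers. Then the direct products $L_{k_1}\times\cdots\times L_{k_m}$ and $L_{r_1}\times\cdots\times L_{r_n}$ are equivalent if and only if the multisets of devices $\{L_{k_1},\dots,L_{k_m}\}$ and $\{L_{r_1},\dots,L_{r_n}\}$ coincide, i.e. the two products consist of the same devices with the same multiplicities. -/

import Mathlib

/-- An abstract storage device: a finite set of states together with a set of partitions of the
states. Partitions are encoded as equivalence relations (`Setoid`), so that `π ≤ ρ` says that `π`
refines `ρ`, `Setoid.comap φ π` is the pullback partition `π ∘ φ`, and `Setoid.ker f` is the kernel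
partition of `f`. The partition set is automatically finite. -/
structure ASD : Type 1 where
  State : Type
  finite_state : Finite State
  parts : Set (Setoid State)

namespace ASD

/-- `D ≤ D'`: there are `φ` on states and `α` on partitions such that `α(π) ∘ φ` refines `π` for
every partition `π` of `D`. -/
def ReducibleTo (D D' : ASD) : Prop :=
  ∃ (φ : D.State → D'.State) (α : D.parts → D'.parts),
    ∀ π : D.parts, Setoid.comap φ (α π).1 ≤ π.1

/-- Two devices are equivalent when each is reducible to the other. -/
def Equivalent (D D' : ASD) : Prop :=
  D.ReducibleTo D' ∧ D'.ReducibleTo D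

/-- The direct product of two devices. -/
def prod (D D' : ASD) : ASD where
  State := D.State × D'.State
  finite_state := by
    have := D.finite_state
    have := D'.finite_state
    infer_instance
  parts := {ρ | ∃ π ∈ D.parts, ∃ π' ∈ D'.parts, ρ = Setoid.prod π π'}

/-- The direct product of a finite family of devices: the states are the tuples of states, and the
partitions are the products of partitions, one chosen from each factor (two tuples are in the same
block iff they are so in every coordinate). The empty product is the trivial one-state device. -/
def directProduct {ι : Type} [Finite ι] (D : ι → ASD) : ASD where
  State := ∀ i, (D i).State
  finite_state := by
    have := fun i => (D i).finite_state
    infer_instance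
  parts := {ρ | ∃ π : ∀ i, Setoid (D i).State, (∀ i, π i ∈ (D i).parts) ∧
    ∀ s t, ρ s t ↔ ∀ i, π i (s i) (t i)}

/-- The linear device `L_{n,k}`: the states are the binary vectors of length `n`, the partitions are
the kernel partitions of all `GF(2)`-linear maps `{0,1}ⁿ → {0,1}ᵏ`. -/
def linearDevice (n k : ℕ) : ASD where
  State := Fin n → ZMod 2
  finite_state := inferInstance
  parts := Set.range fun f : (Fin n → ZMod 2) →ₗ[ZMod 2] (Fin k → ZMod 2) => Setoid.ker f

/-- The binary linear device `L_n = L_{n,1}` (of interest for `n ≥ 1`). -/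
def L (n : ℕ) : ASD := linearDevice n 1

/-- Devices `L_n` with different parameters are different. -/
theorem L_injective : Function.Injective L := by
  intro m n h
  have h1 : Nat.card (L m).State = Nat.card (L n).State := by rw [h]
  have h2 : ∀ n, Nat.card (L n).State = 2 ^ n := by
    intro n
    show Nat.card (Fin n → ZMod 2) = 2 ^ n
    simp [Nat.card_eq_fintype_card, ZMod.card]
  rw [h2, h2] at h1
  exact Nat.pow_right_injective le_rfl h1

/-- The direct product of a family agrees, up to equivalence, with the iterated binary one. -/
theorem directProduct_succ {n : ℕ} (D : Fin (n + 1) → ASD) :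
    (directProduct D).Equivalent ((D 0).prod (directProduct fun i : Fin n => D i.succ)) := by
  constructor
  · have key : ∀ ρ : (directProduct D).parts, ∃ σ : ((D 0).prod
        (directProduct fun i : Fin n => D i.succ)).parts,
        Setoid.comap (fun s : (directProduct D).State => (s 0, fun i : Fin n => s i.succ)) σ.1
          ≤ ρ.1 := by
      rintro ⟨ρ, π, hπ, hρ⟩
      refine ⟨⟨Setoid.prod (π 0) ⟨fun s t => ∀ i : Fin n, π i.succ (s i) (t i), ⟨?_, ?_, ?_⟩⟩,
        π 0, hπ 0, _, ⟨fun i => π i.succ, fun i => hπ _, fun s t => Iff.rfl⟩, rfl⟩, ?_⟩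
      · exact fun s i => (π i.succ).refl _
      · exact fun h i => (π i.succ).symm (h i)
      · exact fun h h' i => (π i.succ).trans (h i) (h' i)
      · intro s t h
        exact (hρ s t).2 (Fin.cases h.1 h.2)
    choose α hα using key
    exact ⟨_, α, hα⟩
  · have key : ∀ σ : ((D 0).prod (directProduct fun i : Fin n => D i.succ)).parts,
        ∃ ρ : (directProduct D).parts,
        Setoid.comap (fun s : (D 0).State × (∀ i : Fin n, (D i.succ).State) =>
          (Fin.cons s.1 s.2 : ∀ i, (D i).State)) ρ.1 ≤ σ.1 := by
      rintro ⟨_, π, hπ, σ, ⟨τ, hτ, hσ⟩, rfl⟩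
      let p : ∀ i, Setoid (D i).State := Fin.cons π τ
      refine ⟨⟨⟨fun s t => ∀ i, p i (s i) (t i), ⟨?_, ?_, ?_⟩⟩, p, Fin.cases hπ hτ,
        fun s t => Iff.rfl⟩, ?_⟩
      · exact fun s i => (p i).refl _
      · exact fun h i => (p i).symm (h i)
      · exact fun h h' i => (p i).trans (h i) (h' i)
      · intro s t h
        exact ⟨h 0, (hσ _ _).2 fun i => h i.succ⟩
    choose α hα using key
    exact ⟨_, α, hα⟩

end ASD

/-! Partitions of a product of linear devices are kernels of tuples of functionals. If all
functionals are nonzero, the kernel has 2 to the number of factors blocks, so equivalent products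
have equally many factors (`ReducibleTo.card_le`). Refinement between such kernels is then equality,
and an equivalence yields a bijection of states under which each tuple `f` of nonzero functionals
corresponds to a tuple `A f` with the same kernel (`ReducibleTo.exists_nonzeroDual`).

Composing the kernels of `f` and `g` as relations leaves only the constraints at coordinates where
`f i = g i` (`exists_common_iff`). Counting blocks recovers the number of agreements, so `A` is a
Hamming isometry (`Equivalent.exists_isometry`). Such isometries preserve the multiset of factor
sizes `2 ^ k i - 1`, which determines the `k i`. -/

namespace ASD

/-! ### Permuting the factors of a direct product -/

/-- The product of a family of equivalence relations. -/
def productSetoid {ι : Type} {S : ι → Type} (π : ∀ i, Setoid (S i)) : Setoid (∀ i, S i) where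
  r s t := ∀ i, π i (s i) (t i)
  iseqv := ⟨fun _ i => (π i).refl _, fun h i => (π i).symm (h i),
    fun h h' i => (π i).trans (h i) (h' i)⟩

theorem directProduct_comp_equiv_le {ι κ : Type} [Finite ι] [Finite κ] (D : κ → ASD)
    (σ : ι ≃ κ) : (directProduct fun i => D (σ i)).ReducibleTo (directProduct D) := by
  have key : ∀ ρ : (directProduct fun i => D (σ i)).parts, ∃ τ : (directProduct D).parts,
      Setoid.comap (fun s : (directProduct fun i => D (σ i)).State =>
        (Equiv.piCongrLeft (fun j => (D j).State) σ s : (directProduct D).State)) τ.1 ≤ ρ.1 := by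
    rintro ⟨ρ, π, hπ, hρ⟩
    let p := Equiv.piCongrLeft (fun j => Setoid (D j).State) σ π
    have hp : ∀ i, p (σ i) = π i := fun i => Equiv.piCongrLeft_apply_apply _ _ _ _
    refine ⟨⟨productSetoid p, p, fun j => ?_, fun s t => Iff.rfl⟩, fun s t h => (hρ s t).2 fun i => ?_⟩
    · obtain ⟨i, rfl⟩ := σ.surjective j
      rw [hp]
      exact hπ i
    · have hq : ∀ s : ∀ i, (D (σ i)).State,
          Equiv.piCongrLeft (fun j => (D j).State) σ s (σ i) = s i :=
        fun s => Equiv.piCongrLeft_apply_apply _ _ _ _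
      have h1 : p (σ i) (Equiv.piCongrLeft (fun j => (D j).State) σ s (σ i))
        (Equiv.piCongrLeft (fun j => (D j).State) σ t (σ i)) := h (σ i)
      rwa [hp, hq s, hq t] at h1
  choose α hα using key
  exact ⟨_, α, hα⟩

/-- Multiplicities are fibre sizes, so bijections between fibres glue to a bijection of index types.
-/
theorem exists_equiv_of_map_univ_eq {ι κ : Type} {α : Type*} [Fintype ι] [Fintype κ] {f : ι → α}
    {g : κ → α} (h : Finset.univ.val.map f = Finset.univ.val.map g) :
    ∃ σ : ι ≃ κ, ∀ i, g (σ i) = f i := by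
  classical
  have hc : ∀ c, Fintype.card {i // f i = c} = Fintype.card {j // g j = c} := by
    intro c
    have := congrArg (Multiset.count c) h
    rw [Fintype.card_subtype, Fintype.card_subtype]
    simpa only [Multiset.count_map, eq_comm, Finset.card_def, Finset.filter_val] using this
  exact ⟨Equiv.ofFiberEquiv fun c => Fintype.equivOfCardEq (hc c),
    fun i => Equiv.ofFiberEquiv_map _ i⟩

/-! ### Reductions between products of linear devices -/

/-- Nonzero linear functionals on `{0,1}ᵏ`. -/
abbrev NonzeroDual (k : ℕ) : Type := {f : Module.Dual (ZMod 2) (Fin k → ZMod 2) // f ≠ 0}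

noncomputable instance (k : ℕ) : Fintype (Module.Dual (ZMod 2) (Fin k → ZMod 2)) :=
  Fintype.ofInjective (fun f => (f : (Fin k → ZMod 2) → ZMod 2)) DFunLike.coe_injective

noncomputable instance (k : ℕ) : DecidableEq (NonzeroDual k) := Classical.decEq _

noncomputable instance (k : ℕ) : Fintype (NonzeroDual k) := Fintype.ofFinite _

theorem card_dual (k : ℕ) : Nat.card (Module.Dual (ZMod 2) (Fin k → ZMod 2)) = 2 ^ k := by
  rw [Module.natCard_eq_pow_finrank (K := ZMod 2), Subspace.dual_finrank_eq]
  simp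

theorem card_nonzeroDual (k : ℕ) : Fintype.card (NonzeroDual k) = 2 ^ k - 1 := by
  classical
  rw [← card_dual, Nat.card_eq_fintype_card, Fintype.card_subtype_compl,
    Fintype.card_subtype_eq]

theorem ker_mem_parts_L {k : ℕ} (f : Module.Dual (ZMod 2) (Fin k → ZMod 2)) :
    (Setoid.ker f : Setoid (L k).State) ∈ (L k).parts := by
  refine ⟨LinearMap.pi fun _ => f, ?_⟩
  ext s t
  exact ⟨fun h => congrFun h 0, fun h => funext fun _ => h⟩

theorem exists_ker_of_mem_parts_L {k : ℕ} {π : Setoid (L k).State} (h : π ∈ (L k).parts) :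
    ∃ f : Module.Dual (ZMod 2) (Fin k → ZMod 2), π = Setoid.ker f := by
  obtain ⟨g, rfl⟩ := h
  refine ⟨LinearMap.proj 0 ∘ₗ g, ?_⟩
  ext s t
  exact ⟨fun h => congrFun h 0, fun h => funext fun i => by rw [Fin.fin_one_eq_zero i]; exact h⟩

/-- The states of a product of linear devices. -/
abbrev Vectors {ι : Type} (k : ι → ℕ) : Type := ∀ i, Fin (k i) → ZMod 2

theorem ReducibleTo.exists_dual {ι κ : Type} [Finite ι] [Finite κ] {k : ι → ℕ} {r : κ → ℕ}
    (h : (directProduct fun i => L (k i)).ReducibleTo (directProduct fun j => L (r j))) :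
    ∃ φ : Vectors k → Vectors r, ∀ f : ∀ i, Module.Dual (ZMod 2) (Fin (k i) → ZMod 2),
      ∃ g : ∀ j, Module.Dual (ZMod 2) (Fin (r j) → ZMod 2), ∀ s t,
        (∀ j, g j (φ s j) = g j (φ t j)) → ∀ i, f i (s i) = f i (t i) := by
  obtain ⟨φ, α, h⟩ := h
  refine ⟨φ, fun f => ?_⟩
  let π : (directProduct fun i => L (k i)).parts :=
    ⟨productSetoid fun i => (Setoid.ker (f i) : Setoid (L (k i)).State),
      fun i => Setoid.ker (f i), fun i => ker_mem_parts_L (f i), fun s t => Iff.rfl⟩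
  obtain ⟨ρ, hρ, hα⟩ := (α π).2
  choose g hg using fun j => exists_ker_of_mem_parts_L (hρ j)
  refine ⟨g, fun s t hst => ?_⟩
  refine h π (x := s) (y := t) ((hα _ _).2 fun j => ?_)
  rw [hg]
  exact hst j

theorem pi_dual_surjective {ι : Type} {k : ι → ℕ} (f : ∀ i, NonzeroDual (k i)) :
    Function.Surjective fun (s : Vectors k) i => (f i).1 (s i) := by
  intro a
  choose s hs using fun i => LinearMap.surjective (f i).2 (a i)
  exact ⟨s, funext hs⟩

theorem ne_zero_of_pi_dual_surjective {κ : Type} {r : κ → ℕ}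
    {g : ∀ j, Module.Dual (ZMod 2) (Fin (r j) → ZMod 2)}
    (h : Function.Surjective fun (s : Vectors r) j => g j (s j)) (j : κ) : g j ≠ 0 := by
  intro hj
  obtain ⟨s, hs⟩ := h fun _ => 1
  have := congrFun hs j
  simp [hj] at this

theorem nonempty_nonzeroDual {k : ℕ} (h : 1 ≤ k) : Nonempty (NonzeroDual k) := by
  rw [← Fintype.card_pos_iff, card_nonzeroDual]
  have : 2 ^ 1 ≤ 2 ^ k := Nat.pow_le_pow_right (by norm_num) h
  omega

/-- If the kernel of `p` contains that of `q`, and `p` is surjective, then `p` factors through `q`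
by a surjection. -/
theorem exists_surjective_factor {S P Q : Type} {p : S → P} {q : S → Q}
    (hp : Function.Surjective p) (h : ∀ s t, q s = q t → p s = p t) (x : P) :
    ∃ e : Q → P, Function.Surjective e ∧ ∀ s, e (q s) = p s := by
  have he : ∀ s, Function.extend q p (fun _ => x) (q s) = p s :=
    fun s => Function.FactorsThrough.extend_apply (fun s t hst => h s t hst) _ s
  refine ⟨Function.extend q p (fun _ => x), fun y => ?_, he⟩
  obtain ⟨s, rfl⟩ := hp y
  exact ⟨_, he s⟩

theorem ReducibleTo.card_le {m n : ℕ} {k : Fin m → ℕ} {r : Fin n → ℕ} (hk : ∀ i, 1 ≤ k i)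
    (h : (directProduct fun i => L (k i)).ReducibleTo (directProduct fun j => L (r j))) :
    m ≤ n := by
  obtain ⟨φ, hφ⟩ := h.exists_dual
  have f : ∀ i, NonzeroDual (k i) := fun i => (nonempty_nonzeroDual (hk i)).some
  obtain ⟨g, hg⟩ := hφ fun i => (f i).1
  obtain ⟨e, he, -⟩ := exists_surjective_factor (q := fun s j => g j (φ s j))
    (pi_dual_surjective f) (fun s t hst => funext (hg s t (congrFun hst))) 0
  have := Fintype.card_le_of_surjective e he
  simp only [Fintype.card_fun, ZMod.card, Fintype.card_fin] at this
  exact (Nat.pow_le_pow_iff_right (by norm_num)).1 this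

theorem exists_dual_ne {k : ℕ} {v w : Fin k → ZMod 2} (h : v ≠ w) :
    ∃ f : Module.Dual (ZMod 2) (Fin k → ZMod 2), f v ≠ f w := by
  obtain ⟨l, hl⟩ := Function.ne_iff.1 h
  exact ⟨LinearMap.proj l, hl⟩

theorem ReducibleTo.exists_nonzeroDual {n : ℕ} {k r : Fin n → ℕ}
    (h : (directProduct fun i => L (k i)).ReducibleTo (directProduct fun j => L (r j))) :
    ∃ φ : Vectors k → Vectors r, Function.Injective φ ∧ ∀ f : ∀ i, NonzeroDual (k i),
      ∃ g : ∀ j, NonzeroDual (r j), ∀ s t,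
        (∀ j, (g j).1 (φ s j) = (g j).1 (φ t j)) ↔ ∀ i, (f i).1 (s i) = (f i).1 (t i) := by
  classical
  obtain ⟨φ, hφ⟩ := h.exists_dual
  refine ⟨φ, fun s t hst => ?_, fun f => ?_⟩
  · funext i
    by_contra hi
    obtain ⟨f, hf⟩ := exists_dual_ne hi
    -- Zero functionals are still allowed here, so a tuple supported at `i` suffices to separate `s`
    -- from `t`.
    obtain ⟨g, hg⟩ := hφ (Function.update 0 i f)
    have := hg s t (fun j => by rw [hst]) i
    rw [Function.update_self] at this
    exact hf this
  · obtain ⟨g, hg⟩ := hφ fun i => (f i).1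
    obtain ⟨e, he, hef⟩ := exists_surjective_factor (q := fun s j => g j (φ s j))
      (pi_dual_surjective f) (fun s t hst => funext (hg s t (congrFun hst))) 0
    -- Equal numbers of factors make `e` a surjective self-map of a finite set; this turns
    -- refinement into equality.
    have hb : Function.Injective e := Finite.injective_iff_surjective.2 he
    have hs : Function.Surjective fun (s : Vectors r) j => g j (s j) := by
      intro a
      obtain ⟨s, hs⟩ := pi_dual_surjective f (e a)
      exact ⟨φ s, hb ((hef s).trans hs)⟩
    refine ⟨fun j => ⟨g j, ne_zero_of_pi_dual_surjective hs j⟩, fun s t => ⟨hg s t, fun hst => ?_⟩⟩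
    have : e (fun j => g j (φ s j)) = e (fun j => g j (φ t j)) :=
      (hef s).trans ((funext hst).trans (hef t).symm)
    exact congrFun (hb this)

/-! ### Composing two kernel partitions -/

/-- Over GF(2), distinct nonzero functionals are linearly independent. -/
theorem exists_eq_and_eq {k : ℕ} {f g : NonzeroDual k} (h : f ≠ g) (a b : ZMod 2) :
    ∃ u, f.1 u = a ∧ g.1 u = b := by
  obtain ⟨v, hv⟩ := LinearMap.surjective f.2 1
  obtain ⟨w, hw⟩ := LinearMap.surjective g.2 1
  obtain ⟨x, hx⟩ : ∃ x, f.1 x ≠ g.1 x := by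
    by_contra! hx
    exact h (Subtype.ext (LinearMap.ext hx))
  -- The images of `v` and `w` under `(f, g)` are `(1, q)` and `(p, 1)`; they fail to span only if
  -- `p = q = 1`, and then `(y, z)` with `y ≠ z` completes a spanning set.
  have key : ∀ p q y z a b : ZMod 2, y ≠ z →
      ∃ c d e : ZMod 2, c + d * p + e * y = a ∧ c * q + d + e * z = b := by decide
  obtain ⟨c, d, e, h1, h2⟩ := key (f.1 w) (g.1 v) (f.1 x) (g.1 x) a b hx
  exact ⟨c • v + d • w + e • x, by simpa [hv] using h1, by simpa [hw] using h2⟩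

theorem exists_common_iff {ι : Type} {k : ι → ℕ} (f g : ∀ i, NonzeroDual (k i))
    (s t : Vectors k) :
    (∃ u : Vectors k, (∀ i, (f i).1 (s i) = (f i).1 (u i)) ∧
        ∀ i, (g i).1 (u i) = (g i).1 (t i)) ↔
      ∀ i, f i = g i → (f i).1 (s i) = (f i).1 (t i) := by
  constructor
  · rintro ⟨u, h1, h2⟩ i hi
    rw [h1, hi, h2]
  · intro h
    have : ∀ i, ∃ u, (f i).1 (s i) = (f i).1 u ∧ (g i).1 u = (g i).1 (t i) := by
      intro i
      by_cases hi : f i = g i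
      · exact ⟨t i, h i hi, rfl⟩
      · obtain ⟨u, h1, h2⟩ := exists_eq_and_eq hi ((f i).1 (s i)) ((g i).1 (t i))
        exact ⟨u, h1.symm, h2⟩
    choose u h1 h2 using this
    exact ⟨u, h1, h2⟩

theorem card_eq_card_of_agree {ι κ : Type} [Fintype ι] [Fintype κ] {k : ι → ℕ} {r : κ → ℕ}
    (f g : ∀ i, NonzeroDual (k i)) (f' g' : ∀ j, NonzeroDual (r j)) (φ : Vectors k → Vectors r)
    (hφ : Function.Bijective φ)
    (hf : ∀ s t, (∀ j, (f' j).1 (φ s j) = (f' j).1 (φ t j)) ↔ ∀ i, (f i).1 (s i) = (f i).1 (t i))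
    (hg : ∀ s t, (∀ j, (g' j).1 (φ s j) = (g' j).1 (φ t j)) ↔
      ∀ i, (g i).1 (s i) = (g i).1 (t i)) :
    Fintype.card {i // f i = g i} = Fintype.card {j // f' j = g' j} := by
  classical
  have hC : ∀ s t, (∀ i, f i = g i → (f i).1 (s i) = (f i).1 (t i)) ↔
      ∀ j, f' j = g' j → (f' j).1 (φ s j) = (f' j).1 (φ t j) := by
    intro s t
    -- Surjectivity of `φ` lets the intermediate point of the composition be pulled back.
    rw [← exists_common_iff, ← exists_common_iff, hφ.surjective.exists]
    simp only [hf, hg]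
  let p : Vectors k → {i // f i = g i} → ZMod 2 := fun s i => (f i).1 (s i)
  let q : Vectors k → {j // f' j = g' j} → ZMod 2 := fun s j => (f' j).1 (φ s j)
  have hpq : ∀ s t, p s = p t ↔ q s = q t := by
    intro s t
    simpa [p, q, funext_iff] using hC s t
  have hres : ∀ {κ : Type} {r : κ → ℕ} (f : ∀ i, NonzeroDual (r i)) (P : κ → Prop),
      Function.Surjective fun (s : Vectors r) (i : {i // P i}) => (f i).1 (s i) := by
    intro κ r f P a
    classical
    obtain ⟨s, hs⟩ := pi_dual_surjective f fun i => if h : P i then a ⟨i, h⟩ else 0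
    refine ⟨s, funext fun i => ?_⟩
    simpa [i.2] using congrFun hs i
  obtain ⟨d, hd, -⟩ := exists_surjective_factor (p := p) (q := q) (hres f _)
    (fun s t => (hpq s t).2) 0
  obtain ⟨e, he, -⟩ := exists_surjective_factor (p := q) (q := p)
    ((hres f' _).comp hφ.surjective) (fun s t => (hpq s t).1) 0
  have h1 := Fintype.card_le_of_surjective d hd
  have h2 := Fintype.card_le_of_surjective e he
  simp only [Fintype.card_fun, ZMod.card] at h1 h2
  exact le_antisymm ((Nat.pow_le_pow_iff_right (by norm_num)).1 h1)
    ((Nat.pow_le_pow_iff_right (by norm_num)).1 h2)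

theorem hammingDist_add_card {ι : Type} [Fintype ι] {X : ι → Type} [∀ i, DecidableEq (X i)]
    (x y : ∀ i, X i) : hammingDist x y + Fintype.card {i // x i = y i} = Fintype.card ι := by
  rw [hammingDist, Fintype.card_subtype, add_comm]
  exact Finset.card_filter_add_card_filter_not (s := Finset.univ) (fun i => x i = y i)

theorem Equivalent.exists_isometry {n : ℕ} {k r : Fin n → ℕ}
    (h : (directProduct fun i => L (k i)).Equivalent (directProduct fun j => L (r j))) :
    ∃ A : (∀ i, NonzeroDual (k i)) ≃ (∀ j, NonzeroDual (r j)),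
      ∀ f g, hammingDist (A f) (A g) = hammingDist f g := by
  obtain ⟨φ, hφ, hA⟩ := h.1.exists_nonzeroDual
  obtain ⟨ψ, hψ, hB⟩ := h.2.exists_nonzeroDual
  have bij : ∀ {k r : Fin n → ℕ} {φ : Vectors k → Vectors r} {ψ : Vectors r → Vectors k},
      Function.Injective φ → Function.Injective ψ → Function.Bijective φ := by
    intro k r φ ψ hφ hψ
    exact (Fintype.bijective_iff_injective_and_card φ).2 ⟨hφ, le_antisymm
      (Fintype.card_le_of_injective φ hφ) (Fintype.card_le_of_injective ψ hψ)⟩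
  have iso : ∀ {k r : Fin n → ℕ} {φ : Vectors k → Vectors r}, Function.Bijective φ →
      (∀ f : ∀ i, NonzeroDual (k i), ∃ g : ∀ j, NonzeroDual (r j), ∀ s t,
        (∀ j, (g j).1 (φ s j) = (g j).1 (φ t j)) ↔ ∀ i, (f i).1 (s i) = (f i).1 (t i)) →
      ∃ A : (∀ i, NonzeroDual (k i)) → (∀ j, NonzeroDual (r j)),
        (∀ f g, hammingDist (A f) (A g) = hammingDist f g) ∧ Function.Injective A := by
    intro k r φ hφ hA
    choose A hA using hA
    have hd : ∀ f g, hammingDist (A f) (A g) = hammingDist f g := by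
      intro f g
      have := card_eq_card_of_agree f g (A f) (A g) φ hφ (hA f) (hA g)
      have := hammingDist_add_card f g
      have := hammingDist_add_card (A f) (A g)
      omega
    refine ⟨A, hd, fun f g hfg => ?_⟩
    rw [← hammingDist_eq_zero, ← hd, hfg, hammingDist_self]
  obtain ⟨A, hd, hAi⟩ := iso (bij hφ hψ) hA
  -- `B` serves only to compare cardinalities; it need not be inverse to `A`.
  obtain ⟨B, -, hBi⟩ := iso (bij hψ hφ) hB
  have : Function.Bijective A := (Fintype.bijective_iff_injective_and_card A).2 ⟨hAi, le_antisymm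
      (Fintype.card_le_of_injective A hAi) (Fintype.card_le_of_injective B hBi)⟩
  exact ⟨Equiv.ofBijective A this, hd⟩

/-! ### Hamming isometries preserve the sizes of the factors -/

section Hamming

variable {ι : Type} [Fintype ι] [DecidableEq ι] {X : ι → Type} [∀ i, DecidableEq (X i)]

theorem hammingDist_update_self (x : ∀ i, X i) {i : ι} {a : X i} (h : a ≠ x i) :
    hammingDist x (Function.update x i a) = 1 := by
  rw [hammingDist, Finset.card_eq_one]
  refine ⟨i, ?_⟩
  ext l
  by_cases hl : l = i
  · subst hl
    simpa using h.symm
  · simp [hl]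

/-- This makes the grouping of the neighbours of `x` by changed coordinate a metric invariant. -/
theorem hammingDist_update_le_one_iff (x : ∀ i, X i) {i j : ι} {a : X i} {b : X j} (ha : a ≠ x i)
    (hb : b ≠ x j) :
    hammingDist (Function.update x i a) (Function.update x j b) ≤ 1 ↔ i = j := by
  constructor
  · intro h
    rw [hammingDist, Finset.card_le_one] at h
    by_contra hij
    refine hij (h i ?_ j ?_)
    · simpa [Function.update_of_ne hij] using ha
    · simpa [Function.update_of_ne (Ne.symm hij)] using hb.symm
  · rintro rfl
    rw [hammingDist, Finset.card_le_one]
    have : ∀ l, Function.update x i a l ≠ Function.update x i b l → l = i := by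
      intro l hl
      by_contra hli
      simp [hli] at hl
    intro l hl l' hl'
    rw [this l (by simpa using hl), this l' (by simpa using hl')]

/-- The points at Hamming distance one from `x`, sorted by the coordinate that is changed. -/
noncomputable def neighborEquiv (x : ∀ i, X i) :
    (Σ i, {a : X i // a ≠ x i}) ≃ {y // hammingDist x y = 1} :=
  Equiv.ofBijective (fun p => ⟨Function.update x p.1 p.2.1, hammingDist_update_self x p.2.2⟩) <| by
    constructor
    · rintro ⟨i, a, ha⟩ ⟨j, b, hb⟩ h
      have h' : Function.update x i a = Function.update x j b := congrArg Subtype.val h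
      have hij : i = j := (hammingDist_update_le_one_iff x ha hb).1 (by rw [h']; simp)
      subst hij
      have := congrFun h' i
      simp only [Function.update_self] at this
      subst this
      rfl
    · rintro ⟨y, hy⟩
      rw [hammingDist, Finset.card_eq_one] at hy
      obtain ⟨i, hi⟩ := hy
      have hl : ∀ l, x l ≠ y l ↔ l = i := fun l => by
        simpa using congrArg (l ∈ ·) hi
      refine ⟨⟨i, y i, ((hl i).2 rfl).symm⟩, Subtype.ext (funext fun l => ?_)⟩
      by_cases h : l = i
      · subst h
        simp
      · simpa [h] using not_not.1 (mt (hl l).1 h)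

end Hamming

/-- The equivalence carries fibres onto fibres, but empty fibres are invisible in a sigma type,
hence `c ≠ 0`. -/
theorem card_filter_eq_of_sigma_equiv {ι : Type} [Fintype ι]
    {X Y : ι → Type} [∀ i, Fintype (X i)] [∀ i, Fintype (Y i)] (e : (Σ i, X i) ≃ Σ i, Y i)
    (he : ∀ p q, (e p).1 = (e q).1 ↔ p.1 = q.1) {c : ℕ} (hc : c ≠ 0) :
    Fintype.card {i // Fintype.card (X i) = c} = Fintype.card {i // Fintype.card (Y i) = c} := by
  classical
  have hfib : ∀ p, Fintype.card (X p.1) = Fintype.card (Y (e p).1) := by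
    intro p
    rw [← Fintype.card_congr (Equiv.sigmaSubtype (β := X) p.1),
      ← Fintype.card_congr (Equiv.sigmaSubtype (β := Y) (e p).1)]
    exact Fintype.card_congr (e.subtypeEquiv fun q => (he q p).symm)
  have hcount : ∀ {Z : ι → Type} [∀ i, Fintype (Z i)],
      Fintype.card {p : Σ i, Z i // Fintype.card (Z p.1) = c} =
        Fintype.card {i // Fintype.card (Z i) = c} * c := by
    intro Z _
    rw [Fintype.card_congr (Equiv.subtypeSigmaEquiv Z fun i => Fintype.card (Z i) = c),
      Fintype.card_sigma, Finset.sum_congr rfl fun i _ => i.2]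
    simp
  apply Nat.eq_of_mul_eq_mul_right (Nat.pos_of_ne_zero hc)
  rw [← hcount, ← hcount]
  exact Fintype.card_congr (e.subtypeEquiv fun p => by rw [hfib])

theorem card_filter_eq_of_isometry {ι : Type} [Fintype ι] {X Y : ι → Type}
    [∀ i, Fintype (X i)] [∀ i, Fintype (Y i)] [∀ i, DecidableEq (X i)] [∀ i, DecidableEq (Y i)]
    (A : (∀ i, X i) ≃ ∀ i, Y i) (hA : ∀ x y, hammingDist (A x) (A y) = hammingDist x y)
    (x : ∀ i, X i) {c : ℕ} (hc : c ≠ 0) :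
    Fintype.card {i // Fintype.card (X i) - 1 = c} =
      Fintype.card {i // Fintype.card (Y i) - 1 = c} := by
  classical
  let E : {y // hammingDist x y = 1} ≃ {y // hammingDist (A x) y = 1} :=
    A.subtypeEquiv fun y => by rw [hA]
  let e := (neighborEquiv x).trans (E.trans (neighborEquiv (A x)).symm)
  have hN : ∀ {Z : ι → Type} [∀ i, DecidableEq (Z i)] (z : ∀ i, Z i)
      (p q : Σ i, {a : Z i // a ≠ z i}),
      hammingDist (neighborEquiv z p).1 (neighborEquiv z q).1 ≤ 1 ↔ p.1 = q.1 :=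
    fun z p q => hammingDist_update_le_one_iff z p.2.2 q.2.2
  have he : ∀ p q, (e p).1 = (e q).1 ↔ p.1 = q.1 := by
    intro p q
    rw [← hN, ← hN]
    simp only [e, Equiv.trans_apply, Equiv.apply_symm_apply]
    exact iff_of_eq (congrArg (· ≤ 1) (hA _ _))
  have := card_filter_eq_of_sigma_equiv e he hc
  simpa only [Fintype.card_subtype_compl, Fintype.card_subtype_eq] using this

/-- Recovers the multiplicity of `0`, which comes from the one-point factors `k i = 1`, from the
total. -/
theorem multiset_eq_of_count_eq {s t : Multiset ℕ} (h : s.card = t.card)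
    (hc : ∀ c ≠ 0, s.count c = t.count c) : s = t := by
  have h1 : s.filter (fun c => ¬ 0 = c) = t.filter (fun c => ¬ 0 = c) := by
    ext c
    by_cases h0 : 0 = c
    · simp [← h0]
    · simpa [Multiset.count_filter, h0] using hc c (Ne.symm h0)
  have h2 : ∀ u : Multiset ℕ, u.count 0 + (u.filter (fun c => ¬ 0 = c)).card = u.card := by
    intro u
    have := congrArg Multiset.card (Multiset.filter_add_not (fun c => 0 = c) u)
    rwa [Multiset.card_add, ← Multiset.countP_eq_card_filter] at this
  ext c
  by_cases h0 : c = 0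
  · subst h0
    have := h2 s
    have := h2 t
    rw [h1] at *
    omega
  · exact hc c h0

theorem Equivalent.map_univ_eq {n : ℕ} {k r : Fin n → ℕ} (hk : ∀ i, 1 ≤ k i) (hr : ∀ j, 1 ≤ r j)
    (h : (directProduct fun i => L (k i)).Equivalent (directProduct fun j => L (r j))) :
    Finset.univ.val.map k = Finset.univ.val.map r := by
  obtain ⟨A, hA⟩ := h.exists_isometry
  have hcount : ∀ c ≠ 0, Fintype.card {i // 2 ^ k i - 1 - 1 = c} =
      Fintype.card {i // 2 ^ r i - 1 - 1 = c} := by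
    intro c hc
    have := card_filter_eq_of_isometry A hA (fun i => (nonempty_nonzeroDual (hk i)).some) hc
    simpa only [card_nonzeroDual] using this
  have hmap : Finset.univ.val.map (fun i => 2 ^ k i - 1 - 1) =
      Finset.univ.val.map (fun i => 2 ^ r i - 1 - 1) := by
    refine multiset_eq_of_count_eq (by simp) fun c hc => ?_
    have := hcount c hc
    rw [Fintype.card_subtype, Fintype.card_subtype] at this
    simpa only [Multiset.count_map, eq_comm, Finset.card_def, Finset.filter_val] using this
  -- One is subtracted for the zero functional and one for the base point; `1 ≤ k` keeps both
  -- subtractions exact.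
  have hlog : ∀ {k : ℕ}, 1 ≤ k → Nat.log 2 (2 ^ k - 1 - 1 + 2) = k := by
    intro k hk
    have : 2 ^ 1 ≤ 2 ^ k := Nat.pow_le_pow_right (by norm_num) hk
    rw [show 2 ^ k - 1 - 1 + 2 = 2 ^ k by omega, Nat.log_pow (by norm_num)]
  have := congrArg (Multiset.map fun c => Nat.log 2 (c + 2)) hmap
  simpa only [Multiset.map_map, Function.comp_def, hlog (hk _), hlog (hr _)] using this

end ASD

theorem mainTheorem7 (m n : ℕ) (k : Fin m → ℕ) (r : Fin n → ℕ)
    (hk : ∀ i, 1 ≤ k i) (hr : ∀ j, 1 ≤ r j) :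
    (ASD.directProduct fun i => ASD.L (k i)).Equivalent
        (ASD.directProduct fun j => ASD.L (r j)) ↔
      Finset.univ.val.map (fun i => ASD.L (k i)) =
        Finset.univ.val.map (fun j => ASD.L (r j)) := by
  constructor
  · intro h
    obtain rfl : m = n := le_antisymm (h.1.card_le hk) (h.2.card_le hr)
    have := congrArg (Multiset.map ASD.L) (h.map_univ_eq hk hr)
    simpa only [Multiset.map_map, Function.comp_def] using this
  · intro h
    obtain rfl : m = n := by simpa using congrArg Multiset.card h
    obtain ⟨σ, hσ⟩ := ASD.exists_equiv_of_map_univ_eq h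
    have h1 : (fun i => ASD.L (k i)) = fun i => ASD.L (r (σ i)) := funext fun i => (hσ i).symm
    have h2 : (fun j => ASD.L (r j)) = fun j => ASD.L (k (σ.symm j)) := by
      funext j
      simpa using (congrFun h1 (σ.symm j)).symm
    constructor
    · rw [h1]
      exact ASD.directProduct_comp_equiv_le (fun j => ASD.L (r j)) σ
    · rw [h2]
      exact ASD.directProduct_comp_equiv_le (fun i => ASD.L (k i)) σ.symm
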